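/- **Setting.** Let $n,m$ be positive integers, $m$ even, $m>n/2$. Let $U\subset\mathbb R^n$ be a bounded domain with smooth boundary $S$ ($U$ lying locally on one side of $S$). Let $A=\sum_{|\alpha|\le m}a_\alpha(x)\partial^\alpha$ be an elliptic operator of order $m$ with real coefficients continuous on $\bar U$, and for $j=1,\dots,m/2$ let $B_j=\sum_{|\beta|\le m_j}b_{j\beta}(x)\partial^\beta$ be boundary operators with real coefficients continuous on $S$, such that at every point of $S$ the normal direction is not characteristic for any $B_j$, $m_j<m$, and $m_j\ne m_k$ for $j\neq k$. Put $$\mathcal D(A)=\{u\in H^m(U):\ B_ju=0 \text{ on } S \text{ in the sense of traces},\ j=1,\dots,m/2\}.$$ The collection $(U,A,B_1,\dots,B_{m/2})$ is called *admissible* if, in addition, $A$ maps $\mathcal D(A)$ one-to-one onto $L^2(U)$ and $A^{-1}$ is self-adjoint in $L^2(U)$. For $f\in L^2(U)$ the solution of $Au=f$ means $u=A^{-1}f\in\mathcal D(A)$. A *Green's function* of the collection is a function $G(x,y)$ with $G(x,\cdot)\in L^2(U)$ for every $x\in U$ and such that, for every $f\in L^2(U)$, the function $x\mapsto\int_U G(x,y)f(y)\,dy$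 is continuous on $U$ and is the solution of $Au=f$. **Theorem 3.3 (Equivalence of three properties).** Let $(U,A,B_1,\dots,B_{m/2})$ be admissible with $m>n/2$. Then a Green's function exists, and for every Green's function $G(x,y)$ the following statements are equivalent: (i) the solution of $Au=1$ is non-negative (almost everywhere on $U$); (ii) $\int_U G(x,y)\,dy\ge 0$ for every $x\in U$; (iii) for every non-negative $f\in L^2(U)$, the solution $u$ of $Au=f$ has non-negative mean value $\frac1{|U|}\int_U u\,dx\ge0$; (iii') for every smooth non-negative $f:U\to\mathbb R$ with $f\in L^2(U)$, the solution $u_f$ of $Au=f$ satisfies $\int_U u_f\,dx\ge0$. -/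

import Mathlib

open MeasureTheory Filter Topology
open scoped ContDiff

noncomputable section

namespace GreenPositivity

/-- The Euclidean space `ℝⁿ`. -/
abbrev E (n : ℕ) : Type := EuclideanSpace ℝ (Fin n)

/-- The multi-indices `α` of length `n` with `|α| = α₁ + ⋯ + αₙ ≤ k`. -/
def multiIndexLE (n k : ℕ) : Finset (Fin n → ℕ) :=
  (Fintype.piFinset fun _ => Finset.range (k + 1)).filter fun α => ∑ i, α i ≤ k

/-- The multi-indices `α` of length `n` with `|α| = k`. -/
def multiIndexEq (n k : ℕ) : Finset (Fin n → ℕ) :=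
  (multiIndexLE n k).filter fun α => ∑ i, α i = k

theorem mem_multiIndexLE {n k : ℕ} {α : Fin n → ℕ} :
    α ∈ multiIndexLE n k ↔ ∑ i, α i ≤ k := by
  simp only [multiIndexLE, Finset.mem_filter, Fintype.mem_piFinset, Finset.mem_range,
    and_iff_right_iff_imp]
  intro h i
  have := Finset.single_le_sum (f := α) (fun j _ => Nat.zero_le _) (Finset.mem_univ i)
  omega

theorem mem_multiIndexEq {n k : ℕ} {α : Fin n → ℕ} :
    α ∈ multiIndexEq n k ↔ ∑ i, α i = k := by
  simp only [multiIndexEq, Finset.mem_filter, mem_multiIndexLE, and_iff_right_iff_imp]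
  exact fun h => h.le

/-! ### Classical and weak derivatives -/

/-- The classical partial derivative `∂φ/∂xᵢ`. -/
def partialDeriv {n : ℕ} (i : Fin n) (φ : E n → ℝ) : E n → ℝ :=
  fun x => fderiv ℝ φ x (EuclideanSpace.single i 1)

/-- The classical derivative `∂^α φ = ∂₁^{α₁} ⋯ ∂ₙ^{αₙ} φ`. -/
def multiDeriv {n : ℕ} (α : Fin n → ℕ) (φ : E n → ℝ) : E n → ℝ :=
  (List.finRange n).foldr (fun i ψ => (partialDeriv i)^[α i] ψ) φ

/-- Lebesgue measure on `U`. -/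
abbrev vol {n : ℕ} (U : Set (E n)) : Measure (E n) := volume.restrict U

/-- `u ∈ L²(U)`. -/
abbrev MemL2 {n : ℕ} (U : Set (E n)) (u : E n → ℝ) : Prop := MemLp u 2 (vol U)

/-- `v ∈ L²(U)` is the weak derivative `∂^α u` on `U`:
`∫_U u ∂^α φ = (-1)^{|α|} ∫_U v φ` for all `φ ∈ C_c^∞(U)`. -/
def HasWeakDeriv {n : ℕ} (U : Set (E n)) (α : Fin n → ℕ) (u v : E n → ℝ) : Prop :=
  MemL2 U v ∧
    ∀ φ : E n → ℝ, ContDiff ℝ ∞ φ → HasCompactSupport φ → tsupport φ ⊆ U →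
      ∫ x in U, u x * multiDeriv α φ x = (-1) ^ (∑ i, α i) * ∫ x in U, v x * φ x

/-- `u` belongs to the Sobolev space `H^k(U)`. -/
def MemSobolev {n : ℕ} (U : Set (E n)) (k : ℕ) (u : E n → ℝ) : Prop :=
  MemL2 U u ∧ ∀ α ∈ multiIndexLE n k, ∃ v, HasWeakDeriv U α u v

open Classical in
/-- The weak derivative `∂^α u` on `U` (unique almost everywhere on `U`; zero if there is none). -/
def weakDeriv {n : ℕ} (U : Set (E n)) (α : Fin n → ℕ) (u : E n → ℝ) : E n → ℝ :=
  if h : ∃ v, HasWeakDeriv U α u v then h.choose else 0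

/-! ### The boundary and traces -/

/-- `ρ` is a smooth defining function of `U` near the boundary point `p`. -/
def IsDefiningFunction {n : ℕ} (U : Set (E n)) (p : E n) (ρ : E n → ℝ) : Prop :=
  ContDiff ℝ ∞ ρ ∧ ρ p = 0 ∧ gradient ρ p ≠ 0 ∧ ∀ᶠ x in 𝓝 p, (x ∈ U ↔ ρ x < 0)

/-- `U` is a bounded domain whose boundary is a smooth hypersurface, with `U` locally on one side
of it. For bounded `U` the boundary is compact, so it has finitely many connected components. -/
structure IsSmoothBoundedDomain {n : ℕ} (U : Set (E n)) : Prop where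
  isOpen : IsOpen U
  isConnected : IsConnected U
  isBounded : Bornology.IsBounded U
  smooth_boundary : ∀ p ∈ frontier U, ∃ ρ, IsDefiningFunction U p ρ

/-- The surface measure on `∂U`: the `(n-1)`-dimensional Hausdorff measure. -/
def surfaceMeasure {n : ℕ} (U : Set (E n)) : Measure (E n) :=
  (μH[(n : ℝ) - 1]).restrict (frontier U)

/-- `t ∈ L²(∂U)` is the trace on `∂U` of `w ∈ H¹(U)`: there are smooth `φ_k` on `ℝⁿ` with
`φ_k → w` in `H¹(U)` and `φ_k → t` in `L²(∂U)`. -/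
def IsTrace {n : ℕ} (U : Set (E n)) (w t : E n → ℝ) : Prop :=
  MemSobolev U 1 w ∧ MemLp t 2 (surfaceMeasure U) ∧
    ∃ φ : ℕ → E n → ℝ, (∀ k, ContDiff ℝ ∞ (φ k)) ∧
      (∀ α ∈ multiIndexLE n 1,
        Tendsto (fun k => eLpNorm (multiDeriv α (φ k) - weakDeriv U α w) 2 (vol U)) atTop (𝓝 0)) ∧
      Tendsto (fun k => eLpNorm (φ k - t) 2 (surfaceMeasure U)) atTop (𝓝 0)

/-! ### Differential operators and boundary value problems -/

/-- A linear differential operator `∑_{|α| ≤ k} c_α(x) ∂^α` with real coefficients, where `k` is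
`order`. Coefficients with `|α| > k` are irrelevant. -/
structure DiffOp (n : ℕ) where
  order : ℕ
  coeff : (Fin n → ℕ) → E n → ℝ

/-- The principal symbol `∑_{|α| = k} c_α(x) ξ^α`, where `k` is the order. -/
def DiffOp.symbol {n : ℕ} (L : DiffOp n) (x ξ : E n) : ℝ :=
  ∑ α ∈ multiIndexEq n L.order, L.coeff α x * ∏ i, ξ i ^ α i

/-- `L u`, computed with the weak derivatives of `u` on `U`. -/
def DiffOp.apply {n : ℕ} (L : DiffOp n) (U : Set (E n)) (u : E n → ℝ) : E n → ℝ :=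
  fun x => ∑ α ∈ multiIndexLE n L.order, L.coeff α x * weakDeriv U α u x

/-- `L u = 0` on `∂U` in the sense of traces: `∑_{|β| ≤ k} c_β tr(∂^β u) = 0` almost everywhere
on `∂U`. -/
def DiffOp.VanishesOnBoundary {n : ℕ} (L : DiffOp n) (U : Set (E n)) (u : E n → ℝ) : Prop :=
  ∃ t : (Fin n → ℕ) → E n → ℝ,
    (∀ β ∈ multiIndexLE n L.order, IsTrace U (weakDeriv U β u) (t β)) ∧
    ∀ᵐ x ∂(surfaceMeasure U), ∑ β ∈ multiIndexLE n L.order, L.coeff β x * t β x = 0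

/-- The data `(U, A, B_1, …, B_{m/2})`. -/
structure Collection (n m : ℕ) where
  U : Set (E n)
  A : DiffOp n
  B : Fin (m / 2) → DiffOp n

namespace Collection

variable {n m : ℕ}

/-- `u ∈ D(A)`: `u ∈ H^m(U)` and `B_j u = 0` on `∂U` for all `j`. -/
def InDomain (P : Collection n m) (u : E n → ℝ) : Prop :=
  MemSobolev P.U m u ∧ ∀ j, (P.B j).VanishesOnBoundary P.U u

/-- `u` solves `A u = f` in `U`, `B_j u = 0` on `∂U`, that is, `u ∈ D(A)` and `A u = f` in
`L²(U)`. -/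
def IsSolution (P : Collection n m) (f u : E n → ℝ) : Prop :=
  P.InDomain u ∧ P.A.apply P.U u =ᵐ[vol P.U] f

/-- The collection `(U, A, B_1, …, B_{m/2})` is admissible. -/
structure Admissible (P : Collection n m) : Prop where
  even_order : Even m
  domain : IsSmoothBoundedDomain P.U
  /-- `A` is an elliptic operator of order `m`. -/
  order_A : P.A.order = m
  continuous_A : ∀ α ∈ multiIndexLE n m, ContinuousOn (P.A.coeff α) (closure P.U)
  elliptic : ∀ x ∈ closure P.U, ∀ ξ : E n, ξ ≠ 0 → P.A.symbol x ξ ≠ 0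
  continuous_B : ∀ j, ∀ β ∈ multiIndexLE n (P.B j).order,
    ContinuousOn ((P.B j).coeff β) (frontier P.U)
  /-- The normal direction is nowhere characteristic for `B_j`. -/
  normal_B : ∀ j, ∀ p ∈ frontier P.U, ∀ ρ, IsDefiningFunction P.U p ρ →
    (P.B j).symbol p (gradient ρ p) ≠ 0
  order_B_lt : ∀ j, (P.B j).order < m
  order_B_injective : Function.Injective fun j => (P.B j).order
  /-- `A` maps `D(A)` one-to-one into `L²(U)`. -/
  injective : ∀ u v, P.InDomain u → P.InDomain v →
    P.A.apply P.U u =ᵐ[vol P.U] P.A.apply P.U v → u =ᵐ[vol P.U] v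
  /-- `A` maps `D(A)` onto `L²(U)`. -/
  surjective : ∀ f, MemL2 P.U f → ∃ u, P.IsSolution f u
  /-- `A⁻¹` is self-adjoint in `L²(U)`: `⟨A⁻¹ f, g⟩ = ⟨f, A⁻¹ g⟩` for all `f, g ∈ L²(U)`, where
  `u = A⁻¹ f` and `v = A⁻¹ g`. (As `A⁻¹` is defined on all of `L²(U)`, symmetry is
  self-adjointness.) -/
  selfAdjoint : ∀ f g u v, MemL2 P.U f → MemL2 P.U g → P.IsSolution f u → P.IsSolution g v →
    ∫ x in P.U, u x * g x = ∫ x in P.U, f x * v x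

/-- `G` is the kernel of the Green's operator `A⁻¹`: for every `f ∈ L²(U)`, the function
`x ↦ ∫_U G(x,y) f(y) dy` is the continuous version of the solution `A⁻¹ f`. For each `x ∈ U` this
determines `G(x,·)` almost everywhere. -/
def IsGreenFunction (P : Collection n m) (G : E n → E n → ℝ) : Prop :=
  (∀ x ∈ P.U, MemL2 P.U (G x)) ∧
    ∀ f, MemL2 P.U f →
      P.IsSolution f (fun x => ∫ y in P.U, G x y * f y) ∧
      ContinuousOn (fun x => ∫ y in P.U, G x y * f y) P.U

end Collection

end GreenPositivity

end

noncomputable section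

namespace GreenPositivity

open FourierTransform SchwartzMap

/-! ### The Fourier transform of functions in `L¹ ∩ L²` -/

section Fourier

variable {V : Type*} [NormedAddCommGroup V] [InnerProductSpace ℝ V] [FiniteDimensional ℝ V]
  [MeasurableSpace V] [BorelSpace V]

/-! Let `v` be the solution of `A v = 1`. Self-adjointness of `A⁻¹` gives `∫ u_f = ∫ v f` for the
solution `u_f` of `A u = f` (`integral_solution`), so the sign of the mean value of `u_f` over all
`f ≥ 0` is governed by the sign of `v`. Moreover `x ↦ ∫ G(x,y) dy` is the continuous version of `v`;
bump functions as `f` turn the integral condition into pointwise non-negativity.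

For existence of `G`, the everywhere defined symmetric operator `A⁻¹` is bounded
(`exists_greenOperator`), and for `m > n/2` its values have continuous versions
(`MemSobolev.exists_continuousOn_ae_eq`). Evaluation at a point of `U` is a limit of averages over
shrinking balls, hence a bounded functional by Banach–Steinhaus, and its Riesz representative is
`G(x,·)` (`exists_inner_eq_eval`).

The Sobolev embedding is interior only: cut off by a test function, show that the Fourier transform
decays enough to be integrable, invert, and glue the local versions. -/

theorem continuous_fourier {w : V → ℂ} (hw : Integrable w) : Continuous (𝓕 w) :=
  VectorFourier.fourierIntegral_continuous Real.continuous_fourierChar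
    (L := innerₗ V) continuous_inner hw

theorem continuous_fourierInv {w : V → ℂ} (hw : Integrable w) : Continuous (𝓕⁻ w) := by
  rw [Real.fourierInv_eq_fourier_comp_neg]
  exact continuous_fourier hw.comp_neg

theorem integral_fourier_mul_eq {f g : V → ℂ} (hf : Integrable f) (hg : Integrable g) :
    ∫ ξ, 𝓕 f ξ * g ξ = ∫ x, f x * 𝓕 g x := by
  have := VectorFourier.integral_fourierIntegral_smul_eq_flip (L := innerₗ V)
    (μ := (volume : Measure V)) (ν := (volume : Measure V))
    Real.continuous_fourierChar continuous_inner hf hg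
  simpa only [flip_innerₗ, smul_eq_mul] using! this

/-- Complex-valued locally integrable functions are determined by testing against Schwartz
functions. -/
theorem ae_eq_of_integral_schwartz {f g : V → ℂ} (hf : LocallyIntegrable f)
    (hg : LocallyIntegrable g) (h : ∀ φ : 𝓢(V, ℂ), ∫ x, φ x * f x = ∫ x, φ x * g x) :
    f =ᵐ[volume] g := by
  refine ae_eq_of_integral_contDiff_smul_eq hf hg fun φ hφ hc => ?_
  have hc' : HasCompactSupport (fun x => (φ x : ℂ)) := hc.comp_left (g := ((↑) : ℝ → ℂ)) rfl
  have := h (hc'.toSchwartzMap (Complex.ofRealCLM.contDiff.comp hφ))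
  simpa only [Complex.real_smul] using! this

/-- Plancherel: the Fourier integral of a function in `L¹ ∩ L²` is in `L²`. -/
theorem memLp_two_fourier {w : V → ℂ} (h1 : Integrable w) (h2 : MemLp w 2) :
    MemLp (𝓕 w) 2 := by
  set W : Lp ℂ 2 (volume : Measure V) := 𝓕 h2.toLp
  have hW := Lp.fourier_toTemperedDistribution_eq (h2.toLp)
  -- The `L²` transform `W` and the Fourier integral of `w` represent the same tempered
  -- distribution.
  refine (memLp_congr_ae ?_).1 (Lp.memLp W)
  refine ae_eq_of_integral_schwartz ((Lp.memLp W).locallyIntegrable (by norm_num))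
    (continuous_fourier h1).locallyIntegrable fun φ => ?_
  have h := congrArg (fun T => T φ) hW
  simp only [TemperedDistribution.fourier_apply, Lp.toTemperedDistribution_apply,
    smul_eq_mul] at h
  rw [← h]
  calc ∫ x, (𝓕 φ) x * h2.toLp w x = ∫ x, 𝓕 (φ : V → ℂ) x * w x := by
        refine integral_congr_ae ?_
        filter_upwards [h2.coeFn_toLp] with x hx
        rw [hx, SchwartzMap.fourier_coe]
    _ = ∫ x, φ x * 𝓕 w x := integral_fourier_mul_eq φ.integrable h1

/-- Holds by duality, with no continuity of `w`: writing a Schwartz function as `𝓕 (𝓕⁻ φ)` moves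
both transforms onto `w`. -/
theorem ae_eq_fourierInv_fourier {w : V → ℂ} (h1 : Integrable w) (h2 : Integrable (𝓕 w)) :
    w =ᵐ[volume] 𝓕⁻ (𝓕 w) := by
  refine ae_eq_of_integral_schwartz h1.locallyIntegrable
    (continuous_fourierInv h2).locallyIntegrable fun φ => ?_
  have e1 : ∫ x, φ x * w x = ∫ x, 𝓕 ((𝓕⁻ φ : 𝓢(V, ℂ)) : V → ℂ) x * w x := by
    rw [← SchwartzMap.fourier_coe, fourier_fourierInv_eq]
  rw [e1, integral_fourier_mul_eq (SchwartzMap.integrable _) h1, Real.fourierInv_eq_fourier_comp_neg,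
    ← integral_fourier_mul_eq φ.integrable h2.comp_neg, ← integral_neg_eq_self]
  refine integral_congr_ae (.of_forall fun x => ?_)
  simp only [neg_neg, SchwartzMap.fourierInv_coe, Real.fourierInv_eq_fourier_neg]

end Fourier

/-- A power weight in every coordinate direction makes an `L²` function integrable, if the power is
more than half the dimension. -/
theorem integrable_of_memLp_coord_pow_mul {n m : ℕ} (hmn : (n : ℝ) / 2 < m) {F : E n → ℂ}
    (h0 : MemLp F 2) (h : ∀ j, MemLp (fun ξ : E n => (ξ j : ℂ) ^ m * F ξ) 2) :
    Integrable F := by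
  have hm : m ≠ 0 := by
    rintro rfl
    have : (0 : ℝ) ≤ (n : ℝ) / 2 := by positivity
    simp only [Nat.cast_zero] at hmn; linarith
  obtain ⟨k, rfl⟩ := Nat.exists_eq_succ_of_ne_zero hm
  -- `F` is bounded by a constant times `J * H` with both factors in `L²`; for `J` this is the
  -- condition `2m > n`.
  set H : E n → ℝ := fun ξ => ‖F ξ‖ + ∑ j, ‖(ξ j : ℂ) ^ (k + 1) * F ξ‖
  have hH : MemLp H 2 := h0.norm.add (memLp_finsetSum _ fun j _ => (h j).norm)
  set J : E n → ℝ := fun ξ => (1 + ‖ξ‖) ^ (-((k + 1 : ℕ) : ℝ))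
  have hJc : Continuous J := by
    refine Continuous.rpow_const (by fun_prop) fun x => Or.inl (by positivity)
  have hJ : MemLp J 2 := by
    rw [memLp_two_iff_integrable_sq hJc.aestronglyMeasurable]
    have := integrable_one_add_norm (E := E n) (μ := volume) (r := 2 * ((k + 1 : ℕ) : ℝ))
      (by rw [finrank_euclideanSpace_fin]; linarith)
    refine this.congr (.of_forall fun ξ => ?_)
    simp only [J]
    rw [← Real.rpow_natCast, ← Real.rpow_mul (by positivity)]
    congr 1; push_cast; ring
  have hI : Integrable (fun ξ => ((n : ℝ) + 1) ^ k * (J ξ * H ξ)) := (hJ.integrable_mul hH).const_mul _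
  refine hI.mono' h0.1 (.of_forall fun ξ => ?_)
  have hpos : (0 : ℝ) < (1 + ‖ξ‖) ^ (k + 1) := by positivity
  have hJξ : J ξ = ((1 + ‖ξ‖) ^ (k + 1))⁻¹ := by
    simp only [J]; rw [Real.rpow_neg (by positivity), Real.rpow_natCast]
  have hnorm : ‖ξ‖ ≤ ∑ j, |ξ j| := by
    rw [EuclideanSpace.norm_eq]
    refine Real.sqrt_le_iff.2 ⟨by positivity, ?_⟩
    simpa using Finset.sum_sq_le_sq_sum_of_nonneg (s := Finset.univ) (f := fun j => |ξ j|)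
      (fun _ _ => abs_nonneg _)
  -- Power mean inequality for the `n + 1` numbers `1, |ξ₁|, …, |ξₙ|`; `Option (Fin n)` indexes
  -- them, with `none` for the `1`.
  have key : (1 + ‖ξ‖) ^ (k + 1) ≤ ((n : ℝ) + 1) ^ k * (1 + ∑ j, |ξ j| ^ (k + 1)) := by
    have := pow_sum_div_card_le_sum_pow (s := (Finset.univ : Finset (Option (Fin n))))
      (f := fun o => o.elim (1 : ℝ) fun j => |ξ j|)
      (by rintro (_ | j) _ <;> simp) k
    simp only [Fintype.sum_option, Option.elim, one_pow, Finset.card_univ, Fintype.card_option,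
      Fintype.card_fin, Nat.cast_add, Nat.cast_one] at this
    rw [div_le_iff₀' (by positivity)] at this
    refine le_trans ?_ this
    gcongr
  have hHξ : H ξ = (1 + ∑ j, |ξ j| ^ (k + 1)) * ‖F ξ‖ := by
    simp only [H, norm_mul, norm_pow, Complex.norm_real, Real.norm_eq_abs, ← Finset.sum_mul]
    ring
  rw [hJξ, hHξ]
  have : ((n : ℝ) + 1) ^ k * (((1 + ‖ξ‖) ^ (k + 1))⁻¹ * ((1 + ∑ j, |ξ j| ^ (k + 1)) * ‖F ξ‖)) =
      (((n : ℝ) + 1) ^ k * (1 + ∑ j, |ξ j| ^ (k + 1))) / (1 + ‖ξ‖) ^ (k + 1) * ‖F ξ‖ := by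
    field_simp
  rw [this]
  exact le_mul_of_one_le_left (norm_nonneg _) ((one_le_div hpos).2 key)

/-! ### Sobolev embedding -/

theorem foldr_iterate_single {n : ℕ} {X : Type*} (g : Fin n → X → X) (j : Fin n) (k : ℕ) (x : X)
    (l : List (Fin n)) (hl : l.Nodup) :
    l.foldr (fun i y => (g i)^[(Pi.single j k : Fin n → ℕ) i] y) x =
      if j ∈ l then (g j)^[k] x else x := by
  induction l with
  | nil => simp
  | cons a l ih =>
    obtain ⟨ha, hl⟩ := List.nodup_cons.1 hl
    rw [List.foldr_cons, ih hl]
    rcases eq_or_ne j a with rfl | hja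
    · simp [ha]
    · simp [hja]

theorem multiDeriv_single {n : ℕ} (j : Fin n) (k : ℕ) (φ : E n → ℝ) :
    multiDeriv (Pi.single j k) φ = (partialDeriv j)^[k] φ := by
  rw [multiDeriv, foldr_iterate_single _ _ _ _ _ (List.nodup_finRange n)]
  simp

/-- The test functions on `U`. -/
structure IsTestFunction {n : ℕ} (U : Set (E n)) (φ : E n → ℝ) : Prop where
  contDiff : ContDiff ℝ ∞ φ
  hasCompactSupport : HasCompactSupport φ
  tsupport_subset : tsupport φ ⊆ U

namespace IsTestFunction

variable {n : ℕ} {U : Set (E n)} {φ : E n → ℝ}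

theorem eq_zero (h : IsTestFunction U φ) {x : E n} (hx : x ∉ U) : φ x = 0 :=
  image_eq_zero_of_notMem_tsupport fun hx' => hx (h.tsupport_subset hx')

theorem mul_right (h : IsTestFunction U φ) {ψ : E n → ℝ} (hψ : ContDiff ℝ ∞ ψ) :
    IsTestFunction U (fun x => φ x * ψ x) :=
  ⟨h.contDiff.mul hψ, h.hasCompactSupport.mul_right,
    (tsupport_mul_subset_left (f := φ) (g := ψ)).trans h.tsupport_subset⟩

theorem partialDeriv (h : IsTestFunction U φ) (j : Fin n) :
    IsTestFunction U (partialDeriv j φ) :=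
  ⟨(h.contDiff.fderiv_right (m := ∞) (by simp)).clm_apply contDiff_const,
    h.hasCompactSupport.fderiv_apply (𝕜 := ℝ) _,
    (tsupport_fderiv_apply_subset ℝ _).trans h.tsupport_subset⟩

theorem memLp_mul (h : IsTestFunction U φ) (hU : IsOpen U) {v : E n → ℝ} (hv : MemL2 U v) :
    MemLp (fun x => φ x * v x) 2 := by
  obtain ⟨C, hC⟩ := h.hasCompactSupport.exists_bound_of_continuous h.contDiff.continuous
  have h1 : MemLp (fun x => φ x * v x) 2 (vol U) :=
    hv.of_le_mul (c := C) (h.contDiff.continuous.aestronglyMeasurable.mul hv.1)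
      (.of_forall fun x => by rw [norm_mul]; gcongr; exact hC x)
  have h2 := (memLp_indicator_iff_restrict hU.measurableSet).2 h1
  refine h2.ae_eq (.of_forall fun x => ?_)
  by_cases hx : x ∈ U
  · simp [hx]
  · simp [hx, h.eq_zero hx]

theorem integrable_mul (h : IsTestFunction U φ) (hU : IsOpen U) {v : E n → ℝ} (hv : MemL2 U v) :
    Integrable (fun x => φ x * v x) := by
  have h1 := (h.memLp_mul hU hv)
  have h2 : Integrable ((tsupport φ).indicator fun x => φ x * v x) := by
    rw [integrable_indicator_iff h.hasCompactSupport.isCompact.measurableSet]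
    have : IsFiniteMeasure (volume.restrict (tsupport φ)) :=
      ⟨by simpa using h.hasCompactSupport.isCompact.measure_lt_top⟩
    exact (h1.restrict _).integrable (by norm_num)
  refine h2.congr (.of_forall fun x => ?_)
  by_cases hx : x ∈ tsupport φ
  · simp [hx]
  · simp [hx, image_eq_zero_of_notMem_tsupport hx]

theorem setIntegral_mul (h : IsTestFunction U φ) (v : E n → ℝ) :
    ∫ x in U, v x * φ x = ∫ x, φ x * v x := by
  rw [setIntegral_eq_integral_of_forall_compl_eq_zero fun x hx => by rw [h.eq_zero hx, mul_zero]]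
  simp only [mul_comm]

end IsTestFunction

/-- `w` is the weak partial derivative `∂v/∂xⱼ` on `U`. -/
def HasWeakPartial {n : ℕ} (U : Set (E n)) (j : Fin n) (v w : E n → ℝ) : Prop :=
  ∀ φ, IsTestFunction U φ → ∫ x in U, v x * partialDeriv j φ x = -∫ x in U, w x * φ x

/-- The pure weak derivatives of a Sobolev function in a coordinate direction. -/
theorem MemSobolev.exists_pure_weak_derivatives {n : ℕ} {U : Set (E n)} {m : ℕ} {u : E n → ℝ}
    (hu : MemSobolev U m u) (j : Fin n) :
    ∃ v : ℕ → E n → ℝ, v 0 = u ∧ (∀ i ≤ m, MemL2 U (v i)) ∧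
      ∀ i < m, HasWeakPartial U j (v i) (v (i + 1)) := by
  -- Order `0` must be `u` itself, not just some a.e. equal function; orders above `m` receive a
  -- junk value.
  have hex : ∀ i, ∃ v, (i = 0 → v = u) ∧ (i ≤ m → HasWeakDeriv U (Pi.single j i) u v) := by
    intro i
    rcases Nat.eq_zero_or_pos i with rfl | hi
    · refine ⟨u, fun _ => rfl, fun _ => ⟨hu.1, fun φ _ _ _ => ?_⟩⟩
      rw [multiDeriv_single]; simp
    · by_cases him : i ≤ m
      · obtain ⟨v, hv⟩ := hu.2 (Pi.single j i) (mem_multiIndexLE.2 (by simpa using him))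
        exact ⟨v, fun h => absurd h hi.ne', fun _ => hv⟩
      · exact ⟨u, fun _ => rfl, fun h => absurd h him⟩
  choose v hv0 hv using hex
  refine ⟨v, hv0 0 rfl, fun i hi => (hv i hi).1, fun i hi φ hφ => ?_⟩
  -- Order `i` tested against `∂ⱼφ` and order `i + 1` tested against `φ` both compute `∫ u ∂ⱼ^{i+1}
  -- φ`.
  have hφ' := hφ.partialDeriv j
  have h1 := (hv i hi.le).2 _ hφ'.contDiff hφ'.hasCompactSupport hφ'.tsupport_subset
  have h2 := (hv (i + 1) hi).2 φ hφ.contDiff hφ.hasCompactSupport hφ.tsupport_subset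
  simp only [multiDeriv_single, Finset.sum_pi_single', Finset.mem_univ, if_true] at h1 h2
  rw [Function.iterate_succ_apply, h1, pow_succ, mul_assoc] at h2
  have := mul_left_cancel₀ (pow_ne_zero i (by norm_num : (-1 : ℝ) ≠ 0)) h2
  rw [this, neg_one_mul]

theorem contDiff_inner_phase {n : ℕ} (ξ : E n) :
    ContDiff ℝ ∞ fun x : E n => -2 * Real.pi * inner ℝ x ξ :=
  contDiff_const.mul (contDiff_id.inner ℝ contDiff_const)

/-- Weak derivatives are tested against real functions only, so the exponential is split and its
real and imaginary parts are absorbed into the test function. -/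
theorem fourier_ofReal_mul {n : ℕ} {U : Set (E n)} {φ v : E n → ℝ} (hU : IsOpen U)
    (hφ : IsTestFunction U φ) (hv : MemL2 U v) (ξ : E n) :
    𝓕 (fun x => ((φ x * v x : ℝ) : ℂ)) ξ =
      ((∫ x in U, v x * (φ x * Real.cos (-2 * Real.pi * inner ℝ x ξ)) : ℝ) : ℂ) +
        ((∫ x in U, v x * (φ x * Real.sin (-2 * Real.pi * inner ℝ x ξ)) : ℝ) : ℂ) * Complex.I := by
  have hc : IsTestFunction U fun x => φ x * Real.cos (-2 * Real.pi * inner ℝ x ξ) :=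
    hφ.mul_right (contDiff_inner_phase ξ).cos
  have hs : IsTestFunction U fun x => φ x * Real.sin (-2 * Real.pi * inner ℝ x ξ) :=
    hφ.mul_right (contDiff_inner_phase ξ).sin
  rw [hc.setIntegral_mul, hs.setIntegral_mul, Real.fourier_eq', ← integral_complex_ofReal,
    ← integral_complex_ofReal, ← integral_mul_const, ← integral_add]
  · refine integral_congr_ae (.of_forall fun x => ?_)
    simp only [smul_eq_mul, Complex.exp_mul_I]
    push_cast
    ring
  · exact (hc.integrable_mul hU hv).ofReal
  · exact (hs.integrable_mul hU hv).ofReal.mul_const _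

theorem partialDeriv_mul_cos {n : ℕ} {φ : E n → ℝ} (hφ : ContDiff ℝ ∞ φ) (ξ : E n) (j : Fin n) :
    partialDeriv j (fun x => φ x * Real.cos (-2 * Real.pi * inner ℝ x ξ)) = fun x =>
      partialDeriv j φ x * Real.cos (-2 * Real.pi * inner ℝ x ξ) +
        2 * Real.pi * ξ j * (φ x * Real.sin (-2 * Real.pi * inner ℝ x ξ)) := by
  funext x
  have h1 : HasFDerivAt φ (fderiv ℝ φ x) x := (hφ.differentiable (by simp) x).hasFDerivAt
  have h2 : HasFDerivAt (fun x : E n => -2 * Real.pi * inner ℝ x ξ)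
      ((-2 * Real.pi) • innerSL ℝ ξ) x := by
    have := ((innerSL ℝ ξ).hasFDerivAt (x := x)).const_mul (-2 * Real.pi)
    simpa [real_inner_comm] using! this
  have := (h1.mul h2.cos).fderiv
  simp only [partialDeriv]
  rw [show (fun x => φ x * Real.cos (-2 * Real.pi * inner ℝ x ξ)) =
    φ * fun x => Real.cos (-2 * Real.pi * inner ℝ x ξ) from rfl, this]
  simp [EuclideanSpace.inner_single_right]
  ring

theorem partialDeriv_mul_sin {n : ℕ} {φ : E n → ℝ} (hφ : ContDiff ℝ ∞ φ) (ξ : E n) (j : Fin n) :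
    partialDeriv j (fun x => φ x * Real.sin (-2 * Real.pi * inner ℝ x ξ)) = fun x =>
      partialDeriv j φ x * Real.sin (-2 * Real.pi * inner ℝ x ξ) -
        2 * Real.pi * ξ j * (φ x * Real.cos (-2 * Real.pi * inner ℝ x ξ)) := by
  funext x
  have h1 : HasFDerivAt φ (fderiv ℝ φ x) x := (hφ.differentiable (by simp) x).hasFDerivAt
  have h2 : HasFDerivAt (fun x : E n => -2 * Real.pi * inner ℝ x ξ)
      ((-2 * Real.pi) • innerSL ℝ ξ) x := by
    have := ((innerSL ℝ ξ).hasFDerivAt (x := x)).const_mul (-2 * Real.pi)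
    simpa [real_inner_comm] using! this
  have := (h1.mul h2.sin).fderiv
  simp only [partialDeriv]
  rw [show (fun x => φ x * Real.sin (-2 * Real.pi * inner ℝ x ξ)) =
    φ * fun x => Real.sin (-2 * Real.pi * inner ℝ x ξ) from rfl, this]
  simp [EuclideanSpace.inner_single_right]
  ring

theorem IsTestFunction.setIntegrable_mul {n : ℕ} {U : Set (E n)} {φ v : E n → ℝ}
    (hφ : IsTestFunction U φ) (hU : IsOpen U) (hv : MemL2 U v) :
    Integrable (fun x => v x * φ x) (vol U) := by
  simpa only [mul_comm] using (hφ.integrable_mul hU hv).restrict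

/-- The Fourier transform of `∂ⱼ(φ v) = (∂ⱼ φ) v + φ ∂ⱼ v`. -/
theorem HasWeakPartial.fourier {n : ℕ} {U : Set (E n)} (hU : IsOpen U) {j : Fin n}
    {v w : E n → ℝ} (h : HasWeakPartial U j v w) (hv : MemL2 U v) (hw : MemL2 U w) {φ : E n → ℝ}
    (hφ : IsTestFunction U φ) (ξ : E n) :
    (2 * Real.pi * Complex.I) * ((ξ j : ℂ) * 𝓕 (fun x => ((φ x * v x : ℝ) : ℂ)) ξ) =
      𝓕 (fun x => ((partialDeriv j φ x * v x : ℝ) : ℂ)) ξ +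
        𝓕 (fun x => ((φ x * w x : ℝ) : ℂ)) ξ := by
  rw [fourier_ofReal_mul hU hφ hv, fourier_ofReal_mul hU hφ hw,
    fourier_ofReal_mul hU (hφ.partialDeriv j) hv]
  have hc : IsTestFunction U fun x => φ x * Real.cos (-2 * Real.pi * inner ℝ x ξ) :=
    hφ.mul_right (contDiff_inner_phase ξ).cos
  have hs : IsTestFunction U fun x => φ x * Real.sin (-2 * Real.pi * inner ℝ x ξ) :=
    hφ.mul_right (contDiff_inner_phase ξ).sin
  have hdc : IsTestFunction U fun x => partialDeriv j φ x * Real.cos (-2 * Real.pi * inner ℝ x ξ) :=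
    (hφ.partialDeriv j).mul_right (contDiff_inner_phase ξ).cos
  have hds : IsTestFunction U fun x => partialDeriv j φ x * Real.sin (-2 * Real.pi * inner ℝ x ξ) :=
    (hφ.partialDeriv j).mul_right (contDiff_inner_phase ξ).sin
  have h1 := h _ hc
  have h2 := h _ hs
  rw [partialDeriv_mul_cos hφ.contDiff] at h1
  rw [partialDeriv_mul_sin hφ.contDiff] at h2
  simp only [mul_add, mul_sub, mul_left_comm (v _) (2 * Real.pi * ξ j)] at h1 h2
  rw [integral_add (hdc.setIntegrable_mul hU hv) ((hs.setIntegrable_mul hU hv).const_mul _),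
    integral_const_mul] at h1
  rw [integral_sub (hds.setIntegrable_mul hU hv) ((hc.setIntegrable_mul hU hv).const_mul _),
    integral_const_mul] at h2
  have h1' := congrArg ((↑) : ℝ → ℂ) h1
  have h2' := congrArg ((↑) : ℝ → ℂ) h2
  push_cast at h1' h2' ⊢
  linear_combination -h1' - Complex.I * h2' +
    2 * Real.pi * ξ j * ((∫ x in U, v x * (φ x * Real.sin (-2 * Real.pi * inner ℝ x ξ)) : ℝ) : ℂ) *
      Complex.I_sq

/-- One factor `ξⱼ` is traded, via `HasWeakPartial.fourier`, for a derivative on the cutoff or a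
shift of the sequence `v`. Both terms have one power less, so the induction runs over all `v` and
`φ` at once and no higher Leibniz rule is needed. -/
theorem memLp_coord_pow_mul_fourier {n : ℕ} {U : Set (E n)} (hU : IsOpen U) (j : Fin n) (k : ℕ)
    (v : ℕ → E n → ℝ) (hv : ∀ i ≤ k, MemL2 U (v i))
    (hd : ∀ i < k, HasWeakPartial U j (v i) (v (i + 1))) (φ : E n → ℝ) (hφ : IsTestFunction U φ) :
    MemLp (fun ξ : E n => (ξ j : ℂ) ^ k * 𝓕 (fun x => ((φ x * v 0 x : ℝ) : ℂ)) ξ) 2 := by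
  induction k generalizing v φ with
  | zero =>
    simp only [pow_zero, one_mul]
    exact memLp_two_fourier (hφ.integrable_mul hU (hv 0 le_rfl)).ofReal
      (hφ.memLp_mul hU (hv 0 le_rfl)).ofReal
  | succ k ih =>
    have h1 := ih v (fun i hi => hv i (by omega)) (fun i hi => hd i (by omega)) _
      (hφ.partialDeriv j)
    have h2 := ih (fun i => v (i + 1)) (fun i hi => hv _ (by omega)) (fun i hi => hd _ (by omega))
      _ hφ
    refine ((h1.add h2).const_mul (2 * Real.pi * Complex.I)⁻¹).ae_eq (.of_forall fun ξ => ?_)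
    have h3 := (hd 0 (by omega)).fourier hU (hv 0 (by omega)) (hv 1 (by omega)) hφ ξ
    have hne : (2 * Real.pi * Complex.I : ℂ) ≠ 0 := by simp [Real.pi_ne_zero]
    simp only [Pi.add_apply, zero_add] at h3 ⊢
    rw [← mul_add, ← h3, pow_succ]
    field_simp

/-- Localized Sobolev embedding. -/
theorem MemSobolev.exists_continuous_ae_eq_mul {n m : ℕ} (hmn : (n : ℝ) / 2 < m) {U : Set (E n)}
    (hU : IsOpen U) {u : E n → ℝ} (hu : MemSobolev U m u) {φ : E n → ℝ}
    (hφ : IsTestFunction U φ) :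
    ∃ g : E n → ℝ, Continuous g ∧ (fun x => φ x * u x) =ᵐ[volume] g := by
  have hw1 : Integrable (fun x => ((φ x * u x : ℝ) : ℂ)) := (hφ.integrable_mul hU hu.1).ofReal
  have hw2 : MemLp (fun x => ((φ x * u x : ℝ) : ℂ)) 2 := (hφ.memLp_mul hU hu.1).ofReal
  have hF := integrable_of_memLp_coord_pow_mul hmn (memLp_two_fourier hw1 hw2) fun j => by
    obtain ⟨v, rfl, hv, hd⟩ := hu.exists_pure_weak_derivatives j
    exact memLp_coord_pow_mul_fourier hU j m v hv hd φ hφ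
  refine ⟨fun x => (𝓕⁻ (𝓕 fun x => ((φ x * u x : ℝ) : ℂ)) x).re,
    Complex.continuous_re.comp (continuous_fourierInv hF), ?_⟩
  filter_upwards [ae_eq_fourierInv_fourier hw1 hF] with x hx
  rw [← hx, Complex.ofReal_re]

/-- Sobolev embedding: for `m > n / 2` a function in `H^m(U)` is almost everywhere equal to a
function that is continuous on `U`. -/
theorem MemSobolev.exists_continuousOn_ae_eq {n m : ℕ} (hmn : (n : ℝ) / 2 < m) {U : Set (E n)}
    (hU : IsOpen U) {u : E n → ℝ} (hu : MemSobolev U m u) :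
    ∃ g : E n → ℝ, ContinuousOn g U ∧ u =ᵐ[vol U] g := by
  have hloc : ∀ x : E n, ∃ (g : E n → ℝ) (V : Set (E n)), Continuous g ∧
      (x ∈ U → x ∈ V ∧ IsOpen V ∧ ∀ᵐ y ∂(volume.restrict V), u y = g y) := by
    intro x
    by_cases hx : x ∈ U
    · obtain ⟨r, hr, hball⟩ := Metric.nhds_basis_closedBall.mem_iff.1 (hU.mem_nhds hx)
      let b : ContDiffBump x := ⟨r / 2, r, by positivity, by linarith⟩
      have hb : IsTestFunction U b := ⟨b.contDiff, b.hasCompactSupport, by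
        rw [b.tsupport_eq]; exact hball⟩
      obtain ⟨g, hg, hug⟩ := hu.exists_continuous_ae_eq_mul hmn hU hb
      refine ⟨g, Metric.ball x (r / 2), hg, fun _ => ⟨Metric.mem_ball_self (by positivity),
        Metric.isOpen_ball, ?_⟩⟩
      filter_upwards [ae_restrict_of_ae hug, ae_restrict_mem measurableSet_ball] with y hy hyb
      rw [← hy, b.one_of_mem_closedBall (Metric.ball_subset_closedBall hyb), one_mul]
    · exact ⟨0, ∅, continuous_const, fun h => absurd h hx⟩
  choose g V hg hV using hloc
  -- Continuous functions that agree a.e. on an open set agree on it, so the local versions glue to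
  -- `x ↦ g x x`.
  have heq : ∀ x ∈ U, ∀ y ∈ V x ∩ U, g y y = g x y := by
    intro x hx y hy
    obtain ⟨hyV, hVo, hyg⟩ := hV y hy.2
    obtain ⟨-, hVx, hxg⟩ := hV x hx
    refine Measure.eqOn_open_of_ae_eq (μ := volume) (U := V y ∩ V x) ?_ (hVo.inter hVx)
      (hg y).continuousOn (hg x).continuousOn ⟨hyV, hy.1⟩
    filter_upwards [ae_restrict_of_ae_restrict_of_subset Set.inter_subset_left hyg,
      ae_restrict_of_ae_restrict_of_subset Set.inter_subset_right hxg] with z h1 h2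
    exact h1.symm.trans h2
  refine ⟨fun x => g x x, fun x hx => ContinuousAt.continuousWithinAt ?_, ?_⟩
  · refine (hg x).continuousAt.congr ?_
    filter_upwards [((hV x hx).2.1.inter hU).mem_nhds ⟨(hV x hx).1, hx⟩] with y hy
    exact (heq x hx y hy).symm
  · rw [EventuallyEq, ae_restrict_iff' hU.measurableSet]
    change volume {x | ¬ (x ∈ U → u x = g x x)} = 0
    refine measure_null_of_locally_null _ fun x hx => ?_
    have hxU : x ∈ U := by by_contra h; exact hx fun h' => absurd h' h
    obtain ⟨hxV, hVo, hxg⟩ := hV x hxU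
    refine ⟨{y | ¬ (y ∈ U → u y = g y y)} ∩ V x,
      inter_mem_nhdsWithin _ (hVo.mem_nhds hxV), ?_⟩
    rw [ae_restrict_iff' hVo.measurableSet] at hxg
    refine measure_mono_null (t := {y | ¬ (y ∈ V x → u y = g x y)}) (fun y hy hyg => hy.1 fun hyU => ?_) hxg
    rw [hyg hy.2, heq x hxU y ⟨hy.2, hyU⟩]

/-! ### Invariance under almost everywhere equality -/

section Congr

variable {n m : ℕ} {U : Set (E n)} {u u' : E n → ℝ}

theorem HasWeakDeriv.congr_left {α : Fin n → ℕ} {v : E n → ℝ} (h : u =ᵐ[vol U] u')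
    (hu : HasWeakDeriv U α u v) : HasWeakDeriv U α u' v := by
  refine ⟨hu.1, fun φ h1 h2 h3 => (integral_congr_ae ?_).trans (hu.2 φ h1 h2 h3)⟩
  filter_upwards [h] with x hx
  rw [hx]

theorem hasWeakDeriv_congr_left (h : u =ᵐ[vol U] u') (α : Fin n → ℕ) :
    HasWeakDeriv U α u = HasWeakDeriv U α u' :=
  funext fun _ => propext ⟨fun hu => hu.congr_left h, fun hu => hu.congr_left h.symm⟩

/-- The two defining predicates coincide, so the same representative is chosen and the equality is
exact, not only a.e. -/
theorem weakDeriv_congr (h : u =ᵐ[vol U] u') (α : Fin n → ℕ) :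
    weakDeriv U α u = weakDeriv U α u' := by
  classical
  have key : ∀ p q : (E n → ℝ) → Prop, p = q →
      (if h : ∃ v, p v then h.choose else 0) = if h : ∃ v, q v then h.choose else 0 := by
    rintro p _ rfl
    rfl
  unfold weakDeriv
  convert! key _ _ (hasWeakDeriv_congr_left h α)

theorem MemSobolev.congr {k : ℕ} (hu : MemSobolev U k u) (h : u =ᵐ[vol U] u') :
    MemSobolev U k u' :=
  ⟨hu.1.ae_eq h, by simpa only [hasWeakDeriv_congr_left h] using hu.2⟩

theorem Collection.IsSolution.congr {P : Collection n m} {f f' : E n → ℝ}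
    (hu : P.IsSolution f u) (h : u =ᵐ[vol P.U] u') (hf : f =ᵐ[vol P.U] f') :
    P.IsSolution f' u' := by
  obtain ⟨⟨h1, h2⟩, h3⟩ := hu
  simp only [DiffOp.VanishesOnBoundary, weakDeriv_congr h] at h2
  refine ⟨⟨h1.congr h, h2⟩, EventuallyEq.trans ?_ hf⟩
  have : P.A.apply P.U u = P.A.apply P.U u' :=
    funext fun x => Finset.sum_congr rfl fun α _ => by rw [weakDeriv_congr h]
  rwa [this] at h3

end Congr

/-! ### The Green's operator and the Green's function -/

theorem L2_inner_eq {X : Type*} [MeasurableSpace X] {μ : Measure X} (f g : Lp ℝ 2 μ) :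
    inner ℝ f g = ∫ x, f x * g x ∂μ := by
  rw [L2.inner_def]
  refine integral_congr_ae (.of_forall fun x => ?_)
  simp [mul_comm]

/-- A function on a Hilbert space that is symmetric for the inner product is a bounded linear
operator. -/
theorem exists_continuousLinearMap_of_symmetric {H : Type*} [NormedAddCommGroup H]
    [InnerProductSpace ℝ H] [CompleteSpace H] (S : H → H)
    (hS : ∀ f g, inner ℝ (S f) g = inner ℝ f (S g)) : ∃ T : H →L[ℝ] H, ∀ f, T f = S f := by
  let T : H →ₗ[ℝ] H :=
    { toFun := S
      map_add' := fun f g => ext_inner_right ℝ fun h => by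
        rw [hS, inner_add_left, inner_add_left, hS, hS]
      map_smul' := fun c f => ext_inner_right ℝ fun h => by
        rw [hS, real_inner_smul_left, RingHom.id_apply, real_inner_smul_left, hS] }
  -- Hellinger–Toeplitz: an everywhere defined symmetric operator is continuous.
  have hT : T.IsSymmetric := hS
  exact ⟨⟨T, hT.continuous⟩, fun _ => rfl⟩

theorem Collection.Admissible.exists_greenOperator {n m : ℕ} {P : Collection n m}
    (hP : P.Admissible) :
    ∃ T : Lp ℝ 2 (vol P.U) →L[ℝ] Lp ℝ 2 (vol P.U), ∀ f : Lp ℝ 2 (vol P.U), P.IsSolution f (T f) := by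
  have hex : ∀ f : Lp ℝ 2 (vol P.U), ∃ u : Lp ℝ 2 (vol P.U), P.IsSolution f u := by
    intro f
    obtain ⟨u, hu⟩ := hP.surjective f (Lp.memLp f)
    have h2 : MemL2 P.U u := hu.1.1.1
    exact ⟨h2.toLp, hu.congr h2.coeFn_toLp.symm .rfl⟩
  choose S hS using hex
  obtain ⟨T, hT⟩ := exists_continuousLinearMap_of_symmetric S fun f g => by
    rw [L2_inner_eq, L2_inner_eq]
    exact hP.selfAdjoint f g _ _ (Lp.memLp f) (Lp.memLp g) (hS f) (hS g)
  exact ⟨T, fun f => by rw [hT]; exact hS f⟩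

/-- If every function in the range of a bounded operator on `L²(U)` has a version that is continuous
on `U`, then the evaluation of that version at a point of `U` is a bounded functional. -/
theorem exists_inner_eq_eval {n : ℕ} {U : Set (E n)} (hU : IsOpen U)
    (T : Lp ℝ 2 (vol U) →L[ℝ] Lp ℝ 2 (vol U)) (w : Lp ℝ 2 (vol U) → E n → ℝ)
    (hw : ∀ f, ContinuousOn (w f) U) (hT : ∀ f, T f =ᵐ[vol U] w f) {x : E n} (hx : x ∈ U) :
    ∃ g : Lp ℝ 2 (vol U), ∀ f, inner ℝ g f = w f x := by
  obtain ⟨r, hr, hball⟩ := Metric.nhds_basis_ball.mem_iff.1 (hU.mem_nhds hx)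
  let B : ℕ → Set (E n) := fun k => Metric.ball x (r / (k + 1))
  have hrpos : ∀ k : ℕ, 0 < r / ((k : ℝ) + 1) := fun k => by positivity
  have hBU : ∀ k, B k ⊆ U := fun k => (Metric.ball_subset_ball
    (div_le_self hr.le (by linarith [(k.cast_nonneg : (0 : ℝ) ≤ k)]))).trans hball
  have hBm : ∀ k, MeasurableSet (B k) := fun k => measurableSet_ball
  have hBfin : ∀ k, vol U (B k) ≠ ⊤ := fun k =>
    ((Measure.restrict_apply_le _ _).trans_lt measure_ball_lt_top).ne
  have hBres : ∀ k, (vol U).restrict (B k) = volume.restrict (B k) := fun k => by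
    rw [Measure.restrict_restrict (hBm k), Set.inter_eq_left.2 (hBU k)]
  -- The average of `T f` over `B k`, written as an inner product with an indicator so that its
  -- boundedness in `f` is evident.
  let L : ℕ → Lp ℝ 2 (vol U) →L[ℝ] ℝ := fun k =>
    (volume.real (B k))⁻¹ •
      (innerSL ℝ (indicatorConstLp 2 (hBm k) (hBfin k) (1 : ℝ))).comp T
  have hL : ∀ k f, L k f = (∫ y in B k, w f y) / volume.real (B k) := by
    intro k f
    simp only [L, _root_.smul_apply, ContinuousLinearMap.comp_apply, innerSL_apply_apply,
      L2.inner_indicatorConstLp_one, smul_eq_mul, hBres]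
    rw [div_eq_inv_mul]
    congr 1
    rw [← hBres]
    exact integral_congr_ae (ae_restrict_of_ae (hT f))
  have hlim : Tendsto (fun k f => L k f) atTop (𝓝 fun f => w f x) := by
    refine tendsto_pi_nhds.2 fun f => ?_
    have hsmall : Tendsto B atTop (𝓝 x).smallSets := by
      rw [Metric.nhds_basis_ball.smallSets.tendsto_right_iff]
      intro ε hε
      have h0 : Tendsto (fun k : ℕ => r / ((k : ℝ) + 1)) atTop (𝓝 0) :=
        tendsto_const_div_atTop_nhds_zero_nat r |>.comp (tendsto_add_atTop_nat 1) |>.congr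
          fun k => by simp
      filter_upwards [h0.eventually_lt_const hε] with k hk
      exact Metric.ball_subset_ball hk.le
    have hc : ContinuousAt (w f) x := (hw f).continuousAt (hU.mem_nhds hx)
    have ho := hc.integral_sub_linear_isLittleO_ae (μ := volume)
      ((hw f).stronglyMeasurableAtFilter hU x hx) hsmall
    have ht := ho.tendsto_div_nhds_zero.add_const (w f x)
    rw [zero_add] at ht
    refine ht.congr fun k => ?_
    have hpos : volume.real (B k) ≠ 0 :=
      (ENNReal.toReal_pos (Metric.measure_ball_pos _ _ (hrpos k)).ne' measure_ball_lt_top.ne).ne'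
    rw [hL, smul_eq_mul]
    field_simp
    ring
  -- Banach–Steinhaus makes the pointwise limit of the `L k` bounded; Riesz represents it.
  refine ⟨(InnerProductSpace.toDual ℝ _).symm (continuousLinearMapOfTendsto L hlim), fun f => ?_⟩
  rw [InnerProductSpace.toDual_symm_apply]
  rfl

theorem Collection.Admissible.exists_isGreenFunction {n m : ℕ} (hmn : (n : ℝ) / 2 < m)
    {P : Collection n m} (hP : P.Admissible) : ∃ G : E n → E n → ℝ, P.IsGreenFunction G := by
  have hU := hP.domain.isOpen
  obtain ⟨T, hT⟩ := hP.exists_greenOperator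
  choose w hw hTw using fun f : Lp ℝ 2 (vol P.U) => (hT f).1.1.exists_continuousOn_ae_eq hmn hU
  have hex : ∀ x, ∃ g : Lp ℝ 2 (vol P.U), x ∈ P.U → ∀ f, inner ℝ g f = w f x := fun x => by
    by_cases hx : x ∈ P.U
    · obtain ⟨g, hg⟩ := exists_inner_eq_eval hU T w hw hTw hx
      exact ⟨g, fun _ => hg⟩
    · exact ⟨0, fun h => absurd h hx⟩
  choose g hg using hex
  refine ⟨fun x y => g x y, fun x _ => Lp.memLp _, fun f hf => ?_⟩
  have heq : ∀ x ∈ P.U, ∫ y in P.U, g x y * f y = w hf.toLp x := by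
    intro x hx
    rw [← hg x hx, L2_inner_eq]
    refine integral_congr_ae ?_
    filter_upwards [hf.coeFn_toLp] with y hy
    rw [hy]
  refine ⟨(hT hf.toLp).congr ((hTw _).trans ?_) hf.coeFn_toLp, (hw hf.toLp).congr heq⟩
  filter_upwards [ae_restrict_mem hU.measurableSet] with x hx
  exact (heq x hx).symm

/-! ### Positivity -/

/-- A function that is continuous on an open set `U` and has non-negative integral against
non-negative test functions is non-negative on `U`. -/
theorem nonneg_of_integral_mul_nonneg {n : ℕ} {U : Set (E n)} (hU : IsOpen U) {v : E n → ℝ}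
    (hv : ContinuousOn v U)
    (h : ∀ φ, IsTestFunction U φ → (∀ x, 0 ≤ φ x) → 0 ≤ ∫ x in U, v x * φ x) :
    ∀ x ∈ U, 0 ≤ v x := by
  intro x hx
  by_contra! hneg
  have hnhds : {y | y ∈ U ∧ v y < 0} ∈ 𝓝 x :=
    (hU.eventually_mem hx).and
      ((hv.continuousAt (hU.mem_nhds hx)).eventually_lt_const hneg)
  obtain ⟨r, hr, hball⟩ := Metric.nhds_basis_closedBall.mem_iff.1 hnhds
  let b : ContDiffBump x := ⟨r / 2, r, by positivity, by linarith⟩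
  have hb : IsTestFunction U b := ⟨b.contDiff, b.hasCompactSupport, by
    rw [b.tsupport_eq]; exact fun y hy => (hball hy).1⟩
  have hout : ∀ y, y ∉ Metric.closedBall x r → b y = 0 := fun y hy =>
    image_eq_zero_of_notMem_tsupport (by rwa [b.tsupport_eq])
  have hle : ∀ y, 0 ≤ -v y * b y := fun y => by
    by_cases hy : y ∈ Metric.closedBall x r
    · exact mul_nonneg (neg_nonneg.2 (hball hy).2.le) b.nonneg
    · rw [hout y hy, mul_zero]
  -- Nothing is known about `v` off `U`; continuity on the whole space comes from the support of `b`
  -- lying in `U`.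
  have hcont : Continuous fun y => -v y * b y :=
    (hv.neg.mul hb.contDiff.continuous.continuousOn).continuous_of_tsupport_subset hU
      ((tsupport_mul_subset_right (f := fun y => -v y) (g := b)).trans hb.tsupport_subset)
  have hpos := hcont.integral_pos_of_hasCompactSupport_nonneg_nonzero (μ := volume)
    hb.hasCompactSupport.mul_left hle (x := x) (mul_ne_zero (neg_ne_zero.2 hneg.ne)
      (by rw [b.one_of_mem_closedBall (Metric.mem_closedBall_self b.rIn_pos.le)]; simp))
  have := h b hb fun y => b.nonneg
  rw [hb.setIntegral_mul] at this
  simp only [neg_mul, integral_neg, mul_comm (v _)] at hpos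
  linarith

namespace Collection

variable {n m : ℕ} {P : Collection n m}

theorem Admissible.ae_eq_of_isSolution (hP : P.Admissible) {f u v : E n → ℝ}
    (hu : P.IsSolution f u) (hv : P.IsSolution f v) : u =ᵐ[vol P.U] v :=
  hP.injective u v hu.1 hv.1 (hu.2.trans hv.2.symm)

theorem Admissible.memL2_one (hP : P.Admissible) : MemL2 P.U fun _ => 1 := by
  have : IsFiniteMeasure (vol P.U) := ⟨by simpa using hP.domain.isBounded.measure_lt_top⟩
  exact memLp_const 1

theorem Admissible.measureReal_pos (hP : P.Admissible) : 0 < volume.real P.U :=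
  ENNReal.toReal_pos (hP.domain.isOpen.measure_pos _ hP.domain.isConnected.nonempty).ne'
    hP.domain.isBounded.measure_lt_top.ne

theorem Admissible.setAverage_nonneg_iff (hP : P.Admissible) (u : E n → ℝ) :
    0 ≤ ⨍ x in P.U, u x ↔ 0 ≤ ∫ x in P.U, u x := by
  rw [setAverage_eq, smul_eq_mul, mul_nonneg_iff_of_pos_left (inv_pos.2 hP.measureReal_pos)]

/-- The total mass of a solution is the integral of the right-hand side against the solution of
`A v = 1`. -/
theorem Admissible.integral_solution (hP : P.Admissible) {f u v : E n → ℝ} (hf : MemL2 P.U f)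
    (hu : P.IsSolution f u) (hv : P.IsSolution (fun _ => 1) v) :
    ∫ x in P.U, u x = ∫ x in P.U, v x * f x := by
  have := hP.selfAdjoint f (fun _ => 1) u v hf hP.memL2_one hu hv
  simpa only [mul_one, mul_comm] using this

end Collection

theorem tfae_of_isGreenFunction {n m : ℕ} {P : Collection n m} (hP : P.Admissible)
    {G : E n → E n → ℝ} (hG : P.IsGreenFunction G) :
    List.TFAE [
      ∀ u, P.IsSolution (fun _ => 1) u → ∀ᵐ x ∂(vol P.U), 0 ≤ u x,
      ∀ x ∈ P.U, 0 ≤ ∫ y in P.U, G x y,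
      ∀ f u, MemL2 P.U f → (∀ᵐ x ∂(vol P.U), 0 ≤ f x) →
        P.IsSolution f u → 0 ≤ ⨍ x in P.U, u x,
      ∀ f u, ContDiffOn ℝ ∞ f P.U → MemL2 P.U f → (∀ x ∈ P.U, 0 ≤ f x) →
        P.IsSolution f u → 0 ≤ ∫ x in P.U, u x] := by
  have hU := hP.domain.isOpen
  -- The function in (ii) is the continuous version of the solution for `f = 1`.
  obtain ⟨hv, hvc⟩ := hG.2 _ hP.memL2_one
  simp only [mul_one] at hv hvc
  tfae_have 2 → 1 := fun h u hu => by
    filter_upwards [hP.ae_eq_of_isSolution hu hv, ae_restrict_mem hU.measurableSet] with x hx hxU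
    rw [hx]
    exact h x hxU
  tfae_have 1 → 3 := fun h f u hf hf0 hu => by
    rw [hP.setAverage_nonneg_iff, hP.integral_solution hf hu hv]
    refine integral_nonneg_of_ae ?_
    filter_upwards [h _ hv, hf0] with x h1 h2
    exact mul_nonneg h1 h2
  tfae_have 3 → 4 := fun h f u _ hf hf0 hu =>
    (hP.setAverage_nonneg_iff u).1 (h f u hf (ae_restrict_of_forall_mem hU.measurableSet hf0) hu)
  -- Test functions are admissible right-hand sides, and continuity upgrades the sign from a.e. to
  -- every point.
  tfae_have 4 → 2 := fun h => by
    refine nonneg_of_integral_mul_nonneg hU hvc fun φ hφ hφ0 => ?_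
    have hφ2 : MemL2 P.U φ := by
      simpa only [mul_one] using (hφ.memLp_mul hU hP.memL2_one).restrict P.U
    obtain ⟨u, hu⟩ := hP.surjective φ hφ2
    rw [← hP.integral_solution hφ2 hu hv]
    exact h φ u hφ.contDiff.contDiffOn hφ2 (fun x _ => hφ0 x) hu
  tfae_finish

end GreenPositivity

end

theorem theorem3p3 (n m : ℕ) (hn : 0 < n) (hm : 0 < m) (hmn : (n : ℝ) / 2 < (m : ℝ))
    (P : GreenPositivity.Collection n m) (hP : P.Admissible) :
    (∃ G : GreenPositivity.E n → GreenPositivity.E n → ℝ, P.IsGreenFunction G) ∧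
    ∀ G : GreenPositivity.E n → GreenPositivity.E n → ℝ, P.IsGreenFunction G →
      List.TFAE [
        -- the solution of `A u = 1` is non-negative
        ∀ u, P.IsSolution (fun _ => 1) u → ∀ᵐ x ∂(GreenPositivity.vol P.U), 0 ≤ u x,
        -- `∫_U G(x,y) dy ≥ 0` for every `x ∈ U`
        ∀ x ∈ P.U, 0 ≤ ∫ y in P.U, G x y,
        -- the mean value of the solution of `A u = f` is non-negative for all non-negative `f`
        ∀ f u, GreenPositivity.MemL2 P.U f → (∀ᵐ x ∂(GreenPositivity.vol P.U), 0 ≤ f x) →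
          P.IsSolution f u → 0 ≤ ⨍ x in P.U, u x,
        -- the same for all smooth non-negative `f`
        ∀ f u, ContDiffOn ℝ ∞ f P.U → GreenPositivity.MemL2 P.U f → (∀ x ∈ P.U, 0 ≤ f x) →
          P.IsSolution f u → 0 ≤ ∫ x in P.U, u x] :=
  ⟨hP.exists_isGreenFunction hmn, fun _ hG => GreenPositivity.tfae_of_isGreenFunction hP hG⟩
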